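/- A (integral) lattice is a finitely generated free \(\mathbb{Z}\)-module \(L\) (of rank \(\ge 0\)) endowed with a nondegenerate symmetric bilinear pairing \(b\colon L\times L\to\mathbb{Z}\); an isomorphism of lattices is a \(\mathbb{Z}\)-linear isomorphism respecting the pairings, and \(\mathrm{Aut}(L)\) is the group of automorphisms of \(L\). A genus is a complete set of isomorphism classes of lattices that are equivalent, over \(\mathbb{R}\) and over \(\mathbb{Z}_p\) for every prime \(p\), to a given lattice. The mass of a (positive definite) genus \(\mathfrak{g}\) is \[ \mathrm{mass}(\mathfrak{g}) = \sum_{L\in\mathfrak{g}} \frac{1}{|\mathrm{Aut}(L)|}. \] Let \([1]\) denote the lattice \(\mathbb{Z}\) with pairing \((x,y)\mapsto xy\). For a genus \(\mathfrak{g}\), the lattices \([1]\oplus L\) with \(L\in\mathfrak{g}\) all belong to one genus, denoted \(\tilde{\mathfrak{g}}\). A genus \(\mathfrak{g}\) is a twig of a genus \(\mathfrak{f}\) if \(\mathfrak{f}=\tilde{\mathfrak{g}}\), and \(\mathfrak{g}\) is slender if \(\mathrm{mass}(\tilde{\mathfrak{g}})\le\mathrm{mass}(\mathfrak{g})\). A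 genus \(\mathfrak{f}\) is idoneal if it is positive definite and every lattice \(L\in\mathfrak{f}\) contains a vector \(v\) with \(b(v,v)=1\). Proposition. Every idoneal genus \(\mathfrak{f}\) has at least one slender twig, i.e. there is a genus \(\mathfrak{g}\) with \(\tilde{\mathfrak{g}}=\mathfrak{f}\) and \(\mathrm{mass}(\mathfrak{f})\le\mathrm{mass}(\mathfrak{g})\). -/

import Mathlib

open scoped TensorProduct ENNReal

/-- An (integral) lattice: a finitely generated free `ℤ`-module with a nondegenerate symmetric
bilinear pairing with values in `ℤ`. The rank may be zero. -/
structure IntegralLattice where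
  /-- The underlying `ℤ`-module. -/
  carrier : Type
  [addCommGroup : AddCommGroup carrier]
  [free : Module.Free ℤ carrier]
  [finite : Module.Finite ℤ carrier]
  /-- The pairing. -/
  form : LinearMap.BilinForm ℤ carrier
  symm : form.IsSymm
  nondegenerate : form.Nondegenerate

namespace IntegralLattice

instance (L : IntegralLattice) : AddCommGroup L.carrier := L.addCommGroup
instance (L : IntegralLattice) : Module.Free ℤ L.carrier := L.free
instance (L : IntegralLattice) : Module.Finite ℤ L.carrier := L.finite

/-- Isomorphism of lattices: there is a `ℤ`-linear equivalence that respects the pairings. -/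
def Iso (L L' : IntegralLattice) : Prop :=
  L.form.Equivalent L'.form

/-- The (type underlying the) automorphism group of a lattice. -/
abbrev Aut (L : IntegralLattice) : Type :=
  L.form.IsometryEquiv L.form

/-- Equivalence of two lattices over a commutative ring `R`: the symmetric bilinear `R`-modules
obtained by extension of scalars to `R` are isometric. -/
def EquivOver (R : Type) [CommRing R] (L L' : IntegralLattice) : Prop :=
  (L.form.baseChange R).Equivalent (L'.form.baseChange R)

/-- Equivalence over `ℝ` and over `ℤ_p` for each prime `p`. -/
def SameGenus (L L' : IntegralLattice) : Prop :=
  EquivOver ℝ L L' ∧ ∀ (p : ℕ) [Fact p.Prime], EquivOver ℤ_[p] L L'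

/-- Positive definite lattices. -/
def PosDef (L : IntegralLattice) : Prop :=
  ∀ x : L.carrier, x ≠ 0 → 0 < L.form x x

/-- The lattice `[1]`: the module `ℤ` with the pairing `(x, y) ↦ x * y`. -/
def one : IntegralLattice where
  carrier := ℤ
  form := LinearMap.mul ℤ ℤ
  symm := ⟨fun x y => mul_comm x y⟩
  nondegenerate :=
    ⟨fun x h => by simpa using h 1, fun y h => by simpa using h 1⟩

/-- The orthogonal direct sum `K ⊕ L`, with the pairing
`((a, x), (b, y)) ↦ K.form a b + L.form x y`. -/
def sum (K L : IntegralLattice) : IntegralLattice where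
  carrier := K.carrier × L.carrier
  form := K.form.comp (LinearMap.fst ℤ K.carrier L.carrier) (LinearMap.fst ℤ K.carrier L.carrier)
    + L.form.comp (LinearMap.snd ℤ K.carrier L.carrier) (LinearMap.snd ℤ K.carrier L.carrier)
  symm := ⟨fun x y => by simp [K.symm.eq x.1 y.1, L.symm.eq x.2 y.2]⟩
  nondegenerate := by
    constructor
    · intro x h
      refine Prod.ext (K.nondegenerate.1 _ fun y => ?_) (L.nondegenerate.1 _ fun y => ?_)
      · simpa using h (y, 0)
      · simpa using h (0, y)
    · intro y h
      refine Prod.ext (K.nondegenerate.2 _ fun x => ?_) (L.nondegenerate.2 _ fun x => ?_)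
      · simpa using h (x, 0)
      · simpa using h (0, x)

theorem sum_form_apply (K L : IntegralLattice) (x y : K.carrier × L.carrier) :
    (sum K L).form x y = K.form x.1 y.1 + L.form x.2 y.2 := rfl

/-- The pairing of `R ⊗ (M ⊕ N)` is the orthogonal sum of those of `R ⊗ M` and `R ⊗ N`. -/
theorem baseChange_sum_apply (R : Type) [CommRing R] {M N : Type} [AddCommGroup M]
    [AddCommGroup N] (B : LinearMap.BilinForm ℤ M) (C : LinearMap.BilinForm ℤ N)
    (x y : R ⊗[ℤ] (M × N)) :
    LinearMap.BilinForm.baseChange R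
        (B.comp (LinearMap.fst ℤ M N) (LinearMap.fst ℤ M N) +
          C.comp (LinearMap.snd ℤ M N) (LinearMap.snd ℤ M N)) x y =
      B.baseChange R (TensorProduct.prodRight ℤ R R M N x).1
          (TensorProduct.prodRight ℤ R R M N y).1 +
        C.baseChange R (TensorProduct.prodRight ℤ R R M N x).2
          (TensorProduct.prodRight ℤ R R M N y).2 := by
  induction x using TensorProduct.induction_on with
  | zero => simp
  | add x x' hx hx' =>
    simp only [map_add, LinearMap.add_apply, Prod.fst_add, Prod.snd_add, hx, hx']
    ring
  | tmul a u =>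
    induction y using TensorProduct.induction_on with
    | zero => simp
    | add y y' hy hy' =>
      simp only [map_add, Prod.fst_add, Prod.snd_add, hy, hy']
      ring
    | tmul b v => simp [add_mul]

theorem equivalent_baseChange_sum (R : Type) [CommRing R] {M N N' : Type} [AddCommGroup M]
    [AddCommGroup N] [AddCommGroup N'] (B : LinearMap.BilinForm ℤ M)
    (C : LinearMap.BilinForm ℤ N) (C' : LinearMap.BilinForm ℤ N')
    (h : (C.baseChange R).Equivalent (C'.baseChange R)) :
    (LinearMap.BilinForm.baseChange R
        (B.comp (LinearMap.fst ℤ M N) (LinearMap.fst ℤ M N) +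
          C.comp (LinearMap.snd ℤ M N) (LinearMap.snd ℤ M N))).Equivalent
      (LinearMap.BilinForm.baseChange R
        (B.comp (LinearMap.fst ℤ M N') (LinearMap.fst ℤ M N') +
          C'.comp (LinearMap.snd ℤ M N') (LinearMap.snd ℤ M N'))) := by
  obtain ⟨e⟩ := h
  refine ⟨LinearMap.BilinForm.IsometryEquiv.mk
    ((TensorProduct.prodRight ℤ R R M N).trans
      (((LinearEquiv.refl R (R ⊗[ℤ] M)).prodCongr e.toLinearEquiv).trans
        (TensorProduct.prodRight ℤ R R M N').symm)) ?_⟩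
  intro x y
  rw [baseChange_sum_apply, baseChange_sum_apply]
  simp

theorem EquivOver.sum_left {R : Type} [CommRing R] (K : IntegralLattice) {L L' : IntegralLattice}
    (h : EquivOver R L L') : EquivOver R (sum K L) (sum K L') :=
  equivalent_baseChange_sum R K.form L.form L'.form h

/-- Isomorphic lattices are equivalent over every ring. -/
theorem Iso.equivOver {L L' : IntegralLattice} (h : Iso L L') (R : Type) [CommRing R] :
    EquivOver R L L' := by
  obtain ⟨e⟩ := h
  refine ⟨LinearMap.BilinForm.IsometryEquiv.mk
    (e.toLinearEquiv.baseChange ℤ R L.carrier L'.carrier) ?_⟩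
  intro x y
  induction x using TensorProduct.induction_on with
  | zero => simp
  | add x x' hx hx' => simp_all
  | tmul a u =>
    induction y using TensorProduct.induction_on with
    | zero => simp
    | add y y' hy hy' => simp_all
    | tmul b v =>
      change (L'.form (e u) (e v)) • (a * b) = (L.form u v) • (a * b)
      rw [e.map_app]

theorem Iso.sameGenus {L L' : IntegralLattice} (h : Iso L L') : SameGenus L L' :=
  ⟨h.equivOver ℝ, fun p _ => h.equivOver ℤ_[p]⟩

theorem SameGenus.refl (L : IntegralLattice) : SameGenus L L :=
  ⟨LinearMap.BilinForm.Equivalent.refl _, fun _ _ => LinearMap.BilinForm.Equivalent.refl _⟩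

theorem SameGenus.symm {L L' : IntegralLattice} (h : SameGenus L L') : SameGenus L' L :=
  ⟨LinearMap.BilinForm.Equivalent.symm h.1,
    fun p _ => LinearMap.BilinForm.Equivalent.symm (h.2 p)⟩

theorem SameGenus.trans {L L' L'' : IntegralLattice} (h : SameGenus L L')
    (h' : SameGenus L' L'') : SameGenus L L'' :=
  ⟨LinearMap.BilinForm.Equivalent.trans h.1 h'.1,
    fun p _ => LinearMap.BilinForm.Equivalent.trans (h.2 p) (h'.2 p)⟩

/-- If `L` and `L'` belong to the same genus, then so do `K ⊕ L` and `K ⊕ L'`. -/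
theorem SameGenus.sum_left (K : IntegralLattice) {L L' : IntegralLattice} (h : SameGenus L L') :
    SameGenus (sum K L) (sum K L') :=
  ⟨EquivOver.sum_left K h.1, fun p _ => EquivOver.sum_left K (h.2 p)⟩

/-- Isomorphism of lattices as an equivalence relation. -/
instance isoSetoid : Setoid IntegralLattice where
  r := Iso
  iseqv :=
    ⟨fun _ => LinearMap.BilinForm.Equivalent.refl _,
      fun h => LinearMap.BilinForm.Equivalent.symm h,
      fun h h' => LinearMap.BilinForm.Equivalent.trans h h'⟩

/-- Isomorphism classes of lattices. -/
abbrev IsoClass : Type 1 := Quotient isoSetoid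

/-- The isomorphism class of a lattice. -/
def isoClass (L : IntegralLattice) : IsoClass := Quotient.mk isoSetoid L

/-- Isomorphic lattices have equally many automorphisms. -/
theorem card_aut_eq {L L' : IntegralLattice} (h : Iso L L') :
    ENat.card L.Aut = ENat.card L'.Aut := by
  obtain ⟨e⟩ := h
  refine ENat.card_congr
    { toFun := fun a => (e.symm.trans a).trans e
      invFun := fun a => (e.trans a).trans e.symm
      left_inv := fun a => ?_
      right_inv := fun a => ?_ }
  · refine DFunLike.ext _ _ fun x => ?_
    have hs : ∀ z, e.symm (e z) = z := e.toLinearEquiv.symm_apply_apply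
    change e.symm (e (a (e.symm (e x)))) = a x
    rw [hs, hs]
  · refine DFunLike.ext _ _ fun x => ?_
    have hs : ∀ z, e (e.symm z) = z := e.toLinearEquiv.apply_symm_apply
    change e (e.symm (a (e (e.symm x)))) = a x
    rw [hs, hs]

/-- The order of the automorphism group, as a function of the isomorphism class. -/
noncomputable def IsoClass.cardAut (c : IsoClass) : ℕ∞ :=
  Quotient.lift (fun L : IntegralLattice => ENat.card L.Aut) (fun _ _ h => card_aut_eq h) c

end IntegralLattice

open IntegralLattice

/-- A genus: a complete set of isomorphism classes of lattices which are equivalent over `ℝ` and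
over `ℤ_p` for each prime `p` to a given lattice. -/
structure LatticeGenus where
  /-- The isomorphism classes that make up the genus. -/
  classes : Set IsoClass
  exists_eq : ∃ L₀ : IntegralLattice, classes = {c | ∃ L, SameGenus L₀ L ∧ c = isoClass L}

namespace LatticeGenus

/-- `L ∈ g`: the isomorphism class of `L` belongs to the genus `g`. -/
instance : Membership IntegralLattice LatticeGenus where
  mem g L := isoClass L ∈ g.classes

/-- The genus of a given lattice. -/
def ofLattice (L₀ : IntegralLattice) : LatticeGenus where
  classes := {c | ∃ L, SameGenus L₀ L ∧ c = isoClass L}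
  exists_eq := ⟨L₀, rfl⟩

/-- The genus of `[1] ⊕ L` for `L ∈ g`. It is written as the set of all classes in the genus of
some such lattice; the proof shows that these genera all coincide. -/
def tilde (g : LatticeGenus) : LatticeGenus where
  classes := {c | ∃ L ∈ g, c ∈ (ofLattice (sum one L)).classes}
  exists_eq := by
    obtain ⟨L₀, h₀⟩ := g.exists_eq
    refine ⟨sum one L₀, Set.ext fun c => ⟨?_, ?_⟩⟩
    · rintro ⟨L, hL, M, hM, rfl⟩
      have hL' : isoClass L ∈ g.classes := hL
      rw [h₀] at hL'
      obtain ⟨L', hL', h⟩ := hL'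
      have hLL' : Iso L L' := Quotient.exact h
      have hL₀ : SameGenus L₀ L :=
        hL'.trans hLL'.sameGenus.symm
      exact ⟨M, (hL₀.sum_left one).trans hM, rfl⟩
    · rintro ⟨M, hM, rfl⟩
      refine ⟨L₀, ?_, M, hM, rfl⟩
      change isoClass L₀ ∈ g.classes
      rw [h₀]
      exact ⟨L₀, SameGenus.refl L₀, rfl⟩

/-- `g` is a twig of `f` if `f` is the genus of `[1] ⊕ L` for `L ∈ g`. -/
def IsTwig (g f : LatticeGenus) : Prop :=
  f = g.tilde

/-- The mass `∑_{L ∈ g} 1 / |Aut L|`, a sum over the isomorphism classes in `g`. It is formed in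
`[0, ∞]`, where such a sum always makes sense. -/
noncomputable def mass (g : LatticeGenus) : ℝ≥0∞ :=
  ∑' c : g.classes, 1 / (IsoClass.cardAut c.1 : ℝ≥0∞)

/-- A positive definite genus. -/
def PosDef (g : LatticeGenus) : Prop :=
  ∀ L : IntegralLattice, L ∈ g → L.PosDef

/-- An idoneal genus: a positive definite genus all of whose lattices contain a vector of
square `1`. -/
def IsIdoneal (f : LatticeGenus) : Prop :=
  f.PosDef ∧ ∀ L : IntegralLattice, L ∈ f → ∃ v : L.carrier, L.form v v = 1

/-- A slender genus. -/
def IsSlender (g : LatticeGenus) : Prop :=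
  g.tilde.mass ≤ g.mass

end LatticeGenus

/-! Every class of an idoneal genus `f` has the form `[1] ⊕ K`. The complements `K` fall into at
most two genera, according to parity. Indeed `[1]` cancels locally as soon as the isometry group is
transitive on vectors of square 1. Over `ℝ` and `ℤ_p` with `p` odd, reflections suffice. Over `ℤ_2`
the only obstruction is whether the vector is characteristic, that is, whether its complement is
even (`exists_isometryEquiv_two_adic`, `SameGenus.of_sum_one`).

Since `{±1} × Aut K` embeds in `Aut ([1] ⊕ K)`, the weight of `[1] ⊕ K` is at most half that of `K`.
Hence the classes with complement of a given parity contribute at most half the mass of the twig of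
that parity (`two_mul_tsum_le_mass`). One parity carries at least half of the mass of `f`, and its
twig is slender. -/

namespace LinearMap.BilinForm

/-! ### Reflections and Eichler transformations. -/

section Reflection

variable {R M : Type*} [CommRing R] [AddCommGroup M] [Module R M] {B : LinearMap.BilinForm R M}

/-- If `δ = 1 - B v w` divides every `B x (v - w)`, then the reflection in `v - w` is defined
over `R`; it maps `v` to `w`. -/
theorem exists_isometryEquiv_of_dvd [IsDomain R] (hB : B.IsSymm) {v w : M} (hv : B v v = 1)
    (hw : B w w = 1) (hδ : 1 - B v w ≠ 0) (h : ∀ x, 1 - B v w ∣ B x (v - w)) :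
    ∃ σ : B.IsometryEquiv B, σ v = w := by
  have hs : ∀ x y, B x y = B y x := fun x y => hB.eq x y
  set δ := 1 - B v w with hδ_def
  set u := v - w with hu
  choose c hc using h
  -- Hence the reflection coefficient `2 * B x u / B u u` is `B x u / δ`, which is `c x`.
  have huu : B u u = 2 * δ := by
    simp only [hu, map_sub, LinearMap.sub_apply, hv, hw, hs w v, hδ_def]; ring
  have hcv : c v = 1 := mul_left_cancel₀ hδ (by rw [← hc, hu, map_sub, hv, mul_one])
  have hcu : c u = 2 := mul_left_cancel₀ hδ (by rw [← hc, huu, mul_comm])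
  let ℓ : M →ₗ[R] R :=
    { toFun := c
      map_add' := fun x y => mul_left_cancel₀ hδ (by
        rw [← hc, mul_add, ← hc, ← hc, map_add, LinearMap.add_apply])
      map_smul' := fun r x => mul_left_cancel₀ hδ (by
        rw [← hc, map_smul, LinearMap.smul_apply, hc x, smul_eq_mul, smul_eq_mul, RingHom.id_apply]
        ring) }
  let r : M →ₗ[R] M := LinearMap.id - ℓ.smulRight u
  have hr : ∀ x, r x = x - c x • u := fun x => rfl
  have hrr : ∀ x, r (r x) = x := by
    intro x
    have h1 : c (r x) = c x - c x * c u := by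
      change ℓ (x - c x • u) = ℓ x - c x * ℓ u
      rw [map_sub, map_smul, smul_eq_mul]
    rw [hr (r x), h1, hr x, hcu]
    module
  refine ⟨⟨LinearEquiv.ofInvolutive r hrr, fun x y => ?_⟩, ?_⟩
  · change B (r x) (r y) = B x y
    simp only [hr, map_sub, map_smul, LinearMap.sub_apply, LinearMap.smul_apply, smul_eq_mul,
      huu, hc, hs u y]
    ring
  · change r v = w
    rw [hr, hcv, hu]
    module

/-- An isometry that maps `v` to `-w` may be replaced by one that maps `v` to `w`. -/
theorem exists_isometryEquiv_of_neg {v w : M} (h : ∃ σ : B.IsometryEquiv B, σ v = -w) :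
    ∃ σ : B.IsometryEquiv B, σ v = w := by
  obtain ⟨σ, hσ⟩ := h
  refine ⟨σ.trans ⟨LinearEquiv.neg R, fun x y => ?_⟩, ?_⟩
  · change B (-x) (-y) = B x y
    simp
  · change -(σ v) = w
    rw [hσ, neg_neg]

/-- The variant of `exists_isometryEquiv_of_dvd` for the reflection in `v + w`. -/
theorem exists_isometryEquiv_of_dvd' [IsDomain R] (hB : B.IsSymm) {v w : M} (hv : B v v = 1)
    (hw : B w w = 1) (hδ : 1 + B v w ≠ 0) (h : ∀ x, 1 + B v w ∣ B x (v + w)) :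
    ∃ σ : B.IsometryEquiv B, σ v = w := by
  refine exists_isometryEquiv_of_neg (exists_isometryEquiv_of_dvd hB hv ?_ ?_ ?_)
  · simpa using hw
  · simpa using hδ
  · simpa using h

/-- The Eichler transformation attached to an isotropic vector `e` and a vector `x` orthogonal
to `e` with `B x x = 2 * q`. -/
theorem exists_isometryEquiv_eichler (hB : B.IsSymm) {e x : M} {q : R} (he : B e e = 0)
    (hex : B e x = 0) (hx : B x x = 2 * q) :
    ∃ σ : B.IsometryEquiv B, ∀ y, σ y = y + B e y • x - (B x y + q * B e y) • e := by
  have hs : ∀ x y, B x y = B y x := fun x y => hB.eq x y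
  have hxe : B x e = 0 := by rw [hs, hex]
  let E (x : M) : M →ₗ[R] M :=
    LinearMap.id + (B e).smulRight x - (B x + q • B e).smulRight e
  have hE : ∀ x y, E x y = y + B e y • x - (B x y + q * B e y) • e := fun x y => rfl
  have h1 : ∀ y, E x (E (-x) y) = y := by
    intro y
    simp only [hE, map_sub, map_add, map_neg, map_smul, LinearMap.neg_apply, smul_eq_mul, he, hex,
      hxe, hx]
    module
  have h2 : ∀ y, E (-x) (E x y) = y := by
    intro y
    simp only [hE, map_sub, map_add, map_neg, map_smul, LinearMap.neg_apply, smul_eq_mul, he, hex,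
      hxe, hx]
    module
  refine ⟨⟨LinearEquiv.ofLinearMap (E x) (E (-x)) (LinearMap.ext h1) (LinearMap.ext h2),
    fun y z => ?_⟩, hE x⟩
  change B (E x y) (E x z) = B y z
  simp only [hE, map_sub, map_add, map_smul, LinearMap.sub_apply, LinearMap.add_apply,
    LinearMap.smul_apply, smul_eq_mul, he, hex, hxe, hx, hs y x, hs y e]
  ring

/-- Over a local domain in which `2` is invertible, the isometry group acts transitively on the
vectors of square `1`. -/
theorem exists_isometryEquiv_of_isUnit_two [IsDomain R] [IsLocalRing R] (h2 : IsUnit (2 : R))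
    (hB : B.IsSymm) {v w : M} (hv : B v v = 1) (hw : B w w = 1) :
    ∃ σ : B.IsometryEquiv B, σ v = w := by
  -- In a local ring one of two summands of a unit is a unit, so reflection in `v - w` or in `v + w`
  -- is available.
  have h : IsUnit ((1 - B v w) + (1 + B v w)) := by convert h2 using 1; ring
  rcases IsLocalRing.isUnit_or_isUnit_of_isUnit_add h with h | h
  · exact exists_isometryEquiv_of_dvd hB hv hw h.ne_zero fun x => h.dvd
  · exact exists_isometryEquiv_of_dvd' hB hv hw h.ne_zero fun x => h.dvd

end Reflection

end LinearMap.BilinForm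

/-! ### Parity in `ℤ_2` and Hensel's lemma. -/

namespace PadicInt

theorem two_dvd_iff_toZMod (x : ℤ_[2]) : 2 ∣ x ↔ toZMod x = 0 := by
  rw [← RingHom.mem_ker, ker_toZMod, maximalIdeal_eq_span_p, Ideal.mem_span_singleton]
  simp

theorem toZMod_two (x : ℤ_[2]) : toZMod (2 * x) = 0 := by
  rw [← two_dvd_iff_toZMod]
  exact dvd_mul_right _ _

theorem isUnit_iff_toZMod (x : ℤ_[2]) : IsUnit x ↔ toZMod x = 1 := by
  have h := two_dvd_iff_toZMod x
  have h' := norm_lt_one_iff_dvd x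
  rw [← not_isUnit_iff] at h'
  push_cast at h'
  rw [← not_iff_not, h', h]
  generalize toZMod x = a
  revert a
  decide

/-- A quadratic polynomial over `ℤ_[2]` with even constant term and odd linear coefficient has a
root. -/
theorem exists_root_quadratic {s u : ℤ_[2]} (q : ℤ_[2]) (hs : toZMod s = 0) (hu : toZMod u = 1) :
    ∃ t : ℤ_[2], s + t * u + t ^ 2 * q = 0 := by
  let F : Polynomial ℤ_[2] := .C s + .C u * .X + .C q * .X ^ 2
  have hs' : ‖s‖ < 1 := by
    rw [norm_lt_one_iff_dvd]
    simpa using (two_dvd_iff_toZMod s).2 hs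
  have hu' : ‖u‖ = 1 := isUnit_iff.1 ((isUnit_iff_toZMod u).2 hu)
  -- Approximate root 0: the value `s` is even and the derivative `u` is a unit.
  have hF : ‖F.aeval (0 : ℤ_[2])‖ < ‖F.derivative.aeval (0 : ℤ_[2])‖ ^ 2 := by
    simpa [F, hu'] using hs'
  obtain ⟨z, hz, -⟩ := hensels_lemma hF
  have hz' : s + u * z + q * z ^ 2 = 0 := by simpa [F] using hz
  exact ⟨z, by linear_combination hz'⟩

end PadicInt

/-! ### Orbits of vectors of square 1 over `ℤ_2`. -/

namespace LinearMap.BilinForm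

section TwoAdic

open PadicInt

variable {M : Type*} [AddCommGroup M] [Module ℤ_[2] M] {B : LinearMap.BilinForm ℤ_[2] M}

/-- Vectors of square `1` that induce the same functional modulo `2` are in one orbit. -/
theorem exists_isometryEquiv_of_toZMod_eq (hB : B.IsSymm) {v w : M} (hv : B v v = 1)
    (hw : B w w = 1) (h : ∀ x, toZMod (B x v) = toZMod (B x w)) :
    ∃ σ : B.IsometryEquiv B, σ v = w := by
  have hb : toZMod (B v w) = 1 := by rw [← h v, hv, map_one]
  obtain ⟨j, hj⟩ : 2 ∣ 1 - B v w := by rw [two_dvd_iff_toZMod, map_sub, hb, map_one, sub_self]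
  have hj' : 1 + B v w = 2 * (1 - j) := by linear_combination -hj
  have key : ∀ u : ℤ_[2], IsUnit u → ∀ a, toZMod a = 0 → 2 * u ∣ a := by
    intro u hu a ha
    obtain ⟨k, rfl⟩ := (two_dvd_iff_toZMod a).2 ha
    exact mul_dvd_mul_left 2 hu.dvd
  -- One of `j`, `1 - j` is a unit. The matching denominator is 2 times a unit and divides the even
  -- numbers `B x (v ∓ w)`.
  by_cases hu : IsUnit j
  · refine exists_isometryEquiv_of_dvd hB hv hw ?_ fun x => ?_
    · rw [hj]
      exact mul_ne_zero two_ne_zero hu.ne_zero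
    · rw [hj]
      exact key j hu _ (by rw [map_sub, map_sub, h, sub_self])
  · have hu' : IsUnit (1 - j) := IsLocalRing.isUnit_one_sub_self_of_mem_nonunits j hu
    refine exists_isometryEquiv_of_dvd' hB hv hw ?_ fun x => ?_
    · rw [hj']
      exact mul_ne_zero two_ne_zero hu'.ne_zero
    · rw [hj']
      exact key _ hu' _ (by rw [map_add, map_add, h, CharTwo.add_self_eq_zero])

theorem exists_isometryEquiv_of_toZMod_eq_zero (hB : B.IsSymm) {v w : M} (hv : B v v = 1)
    (hw : B w w = 1) (h : toZMod (B v w) = 0) : ∃ σ : B.IsometryEquiv B, σ v = w := by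
  have hu : IsUnit (1 - B v w) := by rw [isUnit_iff_toZMod, map_sub, h, map_one, sub_zero]
  exact exists_isometryEquiv_of_dvd hB hv hw hu.ne_zero fun x => hu.dvd

/-- If `v` and `w` are not characteristic and induce different functionals modulo `2`, then some
vector of odd square is orthogonal to `v`, and orthogonal to `w` modulo `2`. -/
theorem exists_odd_orthogonal (hB : B.IsSymm) {v w : M} (hv : B v v = 1)
    {n : M} (hn : B v n = 0) (hnw : toZMod (B w n) = 1)
    (hcv : ¬ ∀ x, toZMod (B x x) = toZMod (B x v))
    (hcw : ¬ ∀ x, toZMod (B x x) = toZMod (B x w)) (hvw : toZMod (B v w) = 1) :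
    ∃ m, B v m = 0 ∧ toZMod (B w m) = 0 ∧ toZMod (B m m) = 1 := by
  have hs : ∀ x y, B x y = B y x := fun x y => hB.eq x y
  by_contra hcon
  have hN : ∀ x, B v x = 0 → toZMod (B w x) = 0 → toZMod (B x x) = 0 := by
    intro x h1 h2
    have h3 : toZMod (B x x) ≠ 1 := fun h3 => hcon ⟨x, h1, h2, h3⟩
    revert h3
    generalize toZMod (B x x) = a
    revert a
    decide
  have two (a : ℤ_[2]) : toZMod (2 * a) = 0 := toZMod_two a
  -- `x = B v x • v + ε n + x'` with `x'` in the common kernel modulo `2`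
  have key : ∀ x, toZMod (B x x) = toZMod (B v x) +
      (toZMod (B w x) + toZMod (B v x)) * toZMod (B n n) := by
    intro x
    set a := B v x with ha
    set k := B w x - B v w * a with hk
    have hu : IsUnit (B w n) := (isUnit_iff_toZMod _).2 hnw
    obtain ⟨μ, hμ⟩ := hu.exists_left_inv
    have hμ1 : toZMod μ = 1 := by simpa [hnw] using congrArg toZMod hμ
    have h := hN (x - a • v - (k * μ) • n) ?_ ?_
    · have hexp : B (x - a • v - (k * μ) • n) (x - a • v - (k * μ) • n) =
          B x x - a ^ 2 + (k * μ) ^ 2 * B n n - 2 * (k * μ * B x n) := by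
        simp only [map_sub, map_smul, LinearMap.sub_apply, LinearMap.smul_apply, smul_eq_mul, hn,
          hv, hs n v, hs n x, hs x v, ← ha]
        ring
      rw [hexp] at h
      simp only [map_sub, map_add, map_mul, map_pow, hμ1, hk, hvw, two] at h ⊢
      revert h
      generalize toZMod (B x x) = p
      generalize toZMod (B w x) = q
      generalize toZMod a = r
      generalize toZMod (B n n) = s
      revert p q r s
      decide
    · simp [hv, hn, ← ha]
    · have : B w (x - a • v - (k * μ) • n) = 0 := by
        rw [map_sub, map_sub, map_smul, map_smul, smul_eq_mul, smul_eq_mul, mul_assoc, hμ, hk,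
          hs w v]
        ring
      rw [this, map_zero]
  -- By `key`, `v` is characteristic if `B n n` is even, and `w` is if `B n n` is odd.
  rcases (by decide : ∀ a : ZMod 2, a = 0 ∨ a = 1) (toZMod (B n n)) with h | h
  · exact hcv fun x => by rw [key x, h, mul_zero, add_zero, hs x v]
  · refine hcw fun x => ?_
    rw [key x, h, hs x w]
    generalize toZMod (B v x) = p
    generalize toZMod (B w x) = q
    revert p q
    decide

/-- Vectors `v`, `w` of square `1` over `ℤ_[2]` are in one orbit if both or neither of them are
characteristic. -/
theorem exists_isometryEquiv_two_adic (hB : B.IsSymm) {v w : M} (hv : B v v = 1) (hw : B w w = 1)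
    (h : (∀ x, toZMod (B x x) = toZMod (B x v)) ↔ ∀ x, toZMod (B x x) = toZMod (B x w)) :
    ∃ σ : B.IsometryEquiv B, σ v = w := by
  have hs : ∀ x y, B x y = B y x := fun x y => hB.eq x y
  have dich := (by decide : ∀ a : ZMod 2, a = 0 ∨ a = 1)
  rcases dich (toZMod (B v w)) with hvw | hvw
  · exact exists_isometryEquiv_of_toZMod_eq_zero hB hv hw hvw
  by_cases hall : ∀ x, toZMod (B x v) = toZMod (B x w)
  · exact exists_isometryEquiv_of_toZMod_eq hB hv hw hall
  have hcv : ¬ ∀ x, toZMod (B x x) = toZMod (B x v) := fun hc =>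
    hall fun x => by rw [← hc x, h.1 hc x]
  have hcw := fun hc => hcv (h.2 hc)
  set b := B v w with hb
  have hwv : B w v = b := hs w v
  -- a vector orthogonal to `v` that pairs to an odd number with `w`
  obtain ⟨n₀, hn₀v, hn₀w⟩ : ∃ n, B v n = 0 ∧ toZMod (B w n) = 1 := by
    push Not at hall
    obtain ⟨x, hx⟩ := hall
    refine ⟨x - B v x • v, by simp [hv], ?_⟩
    simp only [map_sub, map_smul, smul_eq_mul, hwv, map_mul, hvw]
    rw [hs x v, hs x w] at hx
    revert hx
    generalize toZMod (B v x) = p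
    generalize toZMod (B w x) = q
    revert p q
    decide
  obtain ⟨m₀, hm₀v, hm₀w, hm₀⟩ := exists_odd_orthogonal hB hv hn₀v hn₀w hcv hcw hvw
  -- an odd vector orthogonal to `v`, and to `w` modulo `4`
  obtain ⟨m, hmv, ⟨j, hj⟩, hm⟩ : ∃ m, B v m = 0 ∧ 4 ∣ B w m ∧ toZMod (B m m) = 1 := by
    obtain ⟨i, hi⟩ := (two_dvd_iff_toZMod _).2 hm₀w
    -- If `B w m₀` is 2 modulo 4, adding `2 • n₀` repairs it and keeps the square odd.
    rcases dich (toZMod i) with h0 | h1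
    · obtain ⟨j, rfl⟩ := (two_dvd_iff_toZMod _).2 h0
      exact ⟨m₀, hm₀v, ⟨j, by rw [hi]; ring⟩, hm₀⟩
    · obtain ⟨j, hj⟩ : 2 ∣ i + B w n₀ := by
        rw [two_dvd_iff_toZMod, map_add, h1, hn₀w]; decide
      refine ⟨m₀ + (2 : ℤ_[2]) • n₀, ?_, ⟨j, ?_⟩, ?_⟩
      · rw [map_add, map_smul, hm₀v, hn₀v, smul_zero, add_zero]
      · rw [map_add, map_smul, hi, smul_eq_mul]
        linear_combination 2 * hj
      · have hexp : B (m₀ + (2 : ℤ_[2]) • n₀) (m₀ + (2 : ℤ_[2]) • n₀) =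
            B m₀ m₀ + 2 * (2 * B m₀ n₀ + 2 * B n₀ n₀) := by
          simp only [map_add, map_smul, LinearMap.add_apply, LinearMap.smul_apply, smul_eq_mul,
            hs n₀ m₀]
          ring
        rw [hexp, map_add, toZMod_two, hm₀, add_zero]
  obtain ⟨μ, hμ⟩ := ((isUnit_iff_toZMod _).2 hm).exists_left_inv
  -- a vector orthogonal to `v` and `m` that pairs to an odd number with `w`
  obtain ⟨n, hnv, hnm, hnw⟩ : ∃ n, B v n = 0 ∧ B m n = 0 ∧ toZMod (B w n) = 1 := by
    refine ⟨n₀ - (B m n₀ * μ) • m, ?_, ?_, ?_⟩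
    · rw [map_sub, map_smul, hn₀v, hmv, smul_zero, sub_zero]
    · rw [map_sub, map_smul, smul_eq_mul, mul_assoc, hμ, mul_one, sub_self]
    · have : B m n₀ * μ * (4 * j) = 2 * (B m n₀ * μ * (2 * j)) := by ring
      rw [map_sub, map_smul, smul_eq_mul, hj, map_sub, hn₀w, this, toZMod_two, sub_zero]
  -- an isotropic vector orthogonal to `v` and `m`, congruent to `w - v` modulo `2`
  obtain ⟨i, hi⟩ : 2 ∣ 1 - b := by rw [two_dvd_iff_toZMod, map_sub, hvw, map_one, sub_self]
  have hbi : b = 1 - 2 * i := by linear_combination -hi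
  -- The vector `e` below has square `4 * (s + t * B w n + t ^ 2 * B n n)`. Divisibility of `B w m`
  -- by 4, rather than just 2, makes `s` even.
  obtain ⟨t, ht⟩ := exists_root_quadratic (s := i - i ^ 2 - 4 * j ^ 2 * μ) (B n n) (by
    have h4 : 4 * j ^ 2 * μ = 2 * (2 * j ^ 2 * μ) := by ring
    rw [h4, map_sub, toZMod_two, map_sub, map_pow, sub_zero]
    generalize toZMod i = a
    revert a
    decide) hnw
  -- The projection of `w` orthogonal to `v` and `m`, made isotropic by a multiple of `n`.
  obtain ⟨e, he_def⟩ : ∃ e, e = w - b • v - (4 * j * μ) • m + (2 * t) • n := ⟨_, rfl⟩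
  have hve : B v e = 0 := by
    simp only [he_def, map_sub, map_add, map_smul, hv, hmv, hnv, ← hb, smul_eq_mul]; ring
  have hme : B m e = 0 := by
    simp only [he_def, map_sub, map_add, map_smul, hs m w, hs m v, hj, hmv, hnm, smul_eq_mul]
    linear_combination (-4 * j) * hμ
  have hee : B e e = 0 := by
    have h1 : B e e = B e w + 2 * t * B e n := by
      have h := congrArg (B e) he_def
      rw [map_add, map_sub, map_sub, map_smul, map_smul, map_smul, hs e v, hs e m, hve, hme,
        smul_zero, smul_zero, sub_zero, sub_zero, smul_eq_mul] at h
      exact h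
    rw [h1]
    simp only [he_def, map_sub, map_add, map_smul, LinearMap.sub_apply, LinearMap.add_apply,
      LinearMap.smul_apply, hw, hs m w, hj, hnm, hnv, hs n w, ← hb, smul_eq_mul]
    rw [hbi]
    linear_combination 4 * ht
  have hex : B e (v + m) = 0 := by rw [map_add, hs e v, hs e m, hve, hme, add_zero]
  -- The Eichler transformation needs a vector of even square; `v` alone has square 1, hence the odd
  -- vector `m`.
  obtain ⟨q, hq⟩ : 2 ∣ B (v + m) (v + m) := by
    rw [two_dvd_iff_toZMod]
    simp only [map_add, LinearMap.add_apply, hs m v, hmv, hv, hm, map_zero, map_one]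
    decide
  obtain ⟨σ, hσ⟩ := exists_isometryEquiv_eichler hB hee hex hq
  have hσv : σ v = v - e := by
    rw [hσ, hs e v, hve, LinearMap.map_add, LinearMap.add_apply, hv, hs m v, hmv]
    module
  -- As `e` is congruent to `w - v` modulo 2, `v - e` is congruent to `w`, and a reflection
  -- finishes.
  obtain ⟨τ, hτ⟩ := exists_isometryEquiv_of_toZMod_eq hB (v := σ v) (w := w)
    (by rw [σ.map_app, hv]) hw (by
      intro x
      have hexp : B x (σ v) = B x w + 2 * (B x v * (1 - i) + 2 * j * μ * B x m - t * B x n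
          - B x w) := by
        rw [hσv, he_def, hbi]
        simp only [map_sub, map_add, map_smul, smul_eq_mul]
        ring
      rw [hexp, map_add, toZMod_two, add_zero])
  exact ⟨σ.trans τ, hτ⟩

end TwoAdic

end LinearMap.BilinForm

/-! ### Local cancellation of a rank one summand. -/

namespace LinearMap.BilinForm

section UnitSum

variable {R M N : Type*} [CommRing R] [AddCommGroup M] [Module R M] [AddCommGroup N] [Module R N]

/-- The orthogonal sum of the rank one form `(x, y) ↦ x * y` and `B`. -/
def unitSum (B : LinearMap.BilinForm R M) : LinearMap.BilinForm R (R × M) :=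
  LinearMap.BilinForm.comp (LinearMap.mul R R) (LinearMap.fst R R M) (LinearMap.fst R R M) +
    B.comp (LinearMap.snd R R M) (LinearMap.snd R R M)

theorem unitSum_apply (B : LinearMap.BilinForm R M) (x y : R × M) :
    B.unitSum x y = x.1 * y.1 + B x.2 y.2 := rfl

theorem IsSymm.unitSum {B : LinearMap.BilinForm R M} (hB : B.IsSymm) : B.unitSum.IsSymm :=
  ⟨fun x y => by
    change B.unitSum x y = B.unitSum y x
    have h : B x.2 y.2 = B y.2 x.2 := hB.eq x.2 y.2
    rw [unitSum_apply, unitSum_apply, h, mul_comm]⟩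

theorem unitSum_one_zero (B : LinearMap.BilinForm R M) : B.unitSum (1, 0) (1, 0) = 1 := by
  simp [unitSum_apply]

/-- An isometry of orthogonal sums that respects the summands `R` induces an isometry of the
complements. -/
theorem equivalent_of_unitSum {B : LinearMap.BilinForm R M} {C : LinearMap.BilinForm R N}
    (f : B.unitSum.IsometryEquiv C.unitSum) (hf : f (1, 0) = (1, 0)) : B.Equivalent C := by
  have hf' : f.symm (1, 0) = (1, 0) := by
    rw [← hf]
    exact f.toLinearEquiv.symm_apply_apply _
  -- An isometry fixing `(1, 0)` preserves its orthogonal complement.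
  have h1 : ∀ a, f (0, a) = (0, (f (0, a)).2) := fun a => Prod.ext (by
    have h := f.map_app (1, 0) (0, a)
    rw [hf] at h
    simpa [unitSum_apply] using h) rfl
  have h2 : ∀ a, f.symm (0, a) = (0, (f.symm (0, a)).2) := fun a => Prod.ext (by
    have h := f.symm.map_app (1, 0) (0, a)
    rw [hf'] at h
    simpa [unitSum_apply] using h) rfl
  refine ⟨⟨LinearEquiv.ofLinearMap
    (LinearMap.snd R R N ∘ₗ (f.toLinearEquiv : R × M →ₗ[R] R × N) ∘ₗ LinearMap.inr R R M)
    (LinearMap.snd R R M ∘ₗ (f.symm.toLinearEquiv : R × N →ₗ[R] R × M) ∘ₗ LinearMap.inr R R N)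
    (LinearMap.ext fun x => ?_) (LinearMap.ext fun x => ?_), fun x y => ?_⟩⟩
  · change (f (0, (f.symm (0, x)).2)).2 = x
    rw [← h2]
    exact congrArg Prod.snd (f.toLinearEquiv.apply_symm_apply (0, x))
  · change (f.symm (0, (f (0, x)).2)).2 = x
    rw [← h1]
    exact congrArg Prod.snd (f.toLinearEquiv.symm_apply_apply (0, x))
  · change C (f (0, x)).2 (f (0, y)).2 = B x y
    have h := f.map_app (0, y) (0, x)
    rw [h1 x, h1 y] at h
    simpa [unitSum_apply] using h

theorem equivalent_of_unitSum_of_isUnit_two [IsDomain R] [IsLocalRing R] (h2 : IsUnit (2 : R))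
    {B : LinearMap.BilinForm R M} {C : LinearMap.BilinForm R N} (hC : C.IsSymm)
    (h : B.unitSum.Equivalent C.unitSum) : B.Equivalent C := by
  obtain ⟨f⟩ := h
  obtain ⟨σ, hσ⟩ := exists_isometryEquiv_of_isUnit_two h2 hC.unitSum (v := f (1, 0)) (w := (1, 0))
    (by rw [f.map_app, unitSum_one_zero]) C.unitSum_one_zero
  exact equivalent_of_unitSum (f.trans σ) hσ

-- Because `a ^ 2 = a` modulo 2, the first coordinate never obstructs; this turns parity of the
-- complement into an isometry-invariant property of the split vector.
open PadicInt in
theorem unitSum_characteristic_iff {M : Type*} [AddCommGroup M] [Module ℤ_[2] M]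
    (B : LinearMap.BilinForm ℤ_[2] M) :
    (∀ x, toZMod (B.unitSum x x) = toZMod (B.unitSum x (1, 0))) ↔ ∀ x, toZMod (B x x) = 0 := by
  constructor
  · intro h x
    simpa [unitSum_apply] using h (0, x)
  · intro h x
    simp only [unitSum_apply, map_add, map_mul, h, map_zero, mul_one, add_zero]
    generalize toZMod x.1 = a
    revert a
    decide

open PadicInt in
/-- Cancellation over `ℤ_[2]` of a summand of rank one from forms of the same parity. -/
theorem equivalent_of_unitSum_two_adic {M N : Type*} [AddCommGroup M] [Module ℤ_[2] M]
    [AddCommGroup N] [Module ℤ_[2] N] {B : LinearMap.BilinForm ℤ_[2] M}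
    {C : LinearMap.BilinForm ℤ_[2] N} (hC : C.IsSymm)
    (hBC : (∀ x, toZMod (B x x) = 0) ↔ ∀ x, toZMod (C x x) = 0)
    (h : B.unitSum.Equivalent C.unitSum) : B.Equivalent C := by
  obtain ⟨f⟩ := h
  obtain ⟨σ, hσ⟩ := exists_isometryEquiv_two_adic hC.unitSum (v := f (1, 0)) (w := (1, 0))
    (by rw [f.map_app, unitSum_one_zero]) C.unitSum_one_zero (by
      rw [unitSum_characteristic_iff, ← hBC, ← unitSum_characteristic_iff,
        f.toLinearEquiv.surjective.forall]
      refine forall_congr' fun x => ?_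
      change toZMod (C.unitSum (f x) (f x)) = toZMod (C.unitSum (f x) (f (1, 0))) ↔ _
      rw [f.map_app, f.map_app])
  exact equivalent_of_unitSum (f.trans σ) hσ

end UnitSum

end LinearMap.BilinForm

/-! ### From local cancellation to genera; splitting off `[1]`. -/

namespace IntegralLattice

open LinearMap.BilinForm

/-- An even lattice: all squares are even. -/
def IsEven (L : IntegralLattice) : Prop := ∀ x, 2 ∣ L.form x x

theorem baseChange_tmul_apply (R : Type) [CommRing R] {M : Type} [AddCommGroup M]
    (B : LinearMap.BilinForm ℤ M) (a b : R) (u v : M) :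
    B.baseChange R (a ⊗ₜ u) (b ⊗ₜ v) = B u v • (a * b) := rfl

theorem baseChange_isSymm (R : Type) [CommRing R] (L : IntegralLattice) :
    (L.form.baseChange R).IsSymm := by
  refine ⟨fun x y => ?_⟩
  induction x using TensorProduct.induction_on with
  | zero => simp
  | add x x' hx hx' => simp only [map_add, LinearMap.add_apply, hx, hx']
  | tmul a u =>
    induction y using TensorProduct.induction_on with
    | zero => simp
    | add y y' hy hy' => simp only [map_add, LinearMap.add_apply, hy, hy']
    | tmul b v =>
      have h : L.form u v = L.form v u := L.symm.eq u v
      rw [baseChange_tmul_apply, baseChange_tmul_apply, ← h, mul_comm]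

theorem baseChange_mul_apply (R : Type) [CommRing R] (x y : R ⊗[ℤ] ℤ) :
    LinearMap.BilinForm.baseChange R (LinearMap.mul ℤ ℤ) x y =
      TensorProduct.AlgebraTensorModule.rid ℤ R R x *
        TensorProduct.AlgebraTensorModule.rid ℤ R R y := by
  induction x using TensorProduct.induction_on with
  | zero => simp
  | add x x' hx hx' => simp only [map_add, LinearMap.add_apply, hx, hx', add_mul]
  | tmul a u =>
    induction y using TensorProduct.induction_on with
    | zero => simp
    | add y y' hy hy' => simp only [map_add, hy, hy', mul_add]
    | tmul b v =>
      change (u * v) • (a * b) = (u • a) * (v • b)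
      rw [smul_mul_smul_comm]

theorem baseChange_sum_one_equivalent (R : Type) [CommRing R] (L : IntegralLattice) :
    ((sum one L).form.baseChange R).Equivalent (L.form.baseChange R).unitSum := by
  refine ⟨LinearMap.BilinForm.IsometryEquiv.mk
    ((TensorProduct.prodRight ℤ R R ℤ L.carrier).trans
      ((TensorProduct.AlgebraTensorModule.rid ℤ R R).prodCongr
        (LinearEquiv.refl R (R ⊗[ℤ] L.carrier)))) fun x y => ?_⟩
  refine Eq.trans ?_ (baseChange_sum_apply R (LinearMap.mul ℤ ℤ) L.form x y).symm
  rw [baseChange_mul_apply]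
  rfl

/-- Cross terms in a square carry a factor 2, so parity is decided on pure tensors. -/
theorem isEven_iff_baseChange (L : IntegralLattice) :
    L.IsEven ↔ ∀ x, PadicInt.toZMod (L.form.baseChange ℤ_[2] x x) = 0 := by
  have key (k : ℤ) : PadicInt.toZMod (k : ℤ_[2]) = 0 ↔ 2 ∣ k := by
    rw [map_intCast]
    exact ZMod.intCast_zmod_eq_zero_iff_dvd k 2
  constructor
  · intro h x
    induction x using TensorProduct.induction_on with
    | zero => simp
    | add x y hx hy =>
      have hs : L.form.baseChange ℤ_[2] y x = L.form.baseChange ℤ_[2] x y :=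
        (baseChange_isSymm ℤ_[2] L).eq y x
      have hxy : L.form.baseChange ℤ_[2] (x + y) (x + y) = L.form.baseChange ℤ_[2] x x +
          L.form.baseChange ℤ_[2] y y + 2 * L.form.baseChange ℤ_[2] x y := by
        simp only [map_add, LinearMap.add_apply, hs]
        ring
      rw [hxy, map_add, map_add, hx, hy, PadicInt.toZMod_two, add_zero, add_zero]
    | tmul a u =>
      rw [baseChange_tmul_apply, zsmul_eq_mul, map_mul, (key _).2 (h u), zero_mul]
  · intro h x
    have hx := h (1 ⊗ₜ x)
    rwa [baseChange_tmul_apply, mul_one, zsmul_one, key] at hx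

/-- A genus has at most one twig of either parity. -/
theorem SameGenus.of_sum_one {K K' : IntegralLattice} (h : SameGenus (sum one K) (sum one K'))
    (hK : K.IsEven ↔ K'.IsEven) : SameGenus K K' := by
  have key {R : Type} [CommRing R] (h : EquivOver R (sum one K) (sum one K')) :
      (K.form.baseChange R).unitSum.Equivalent (K'.form.baseChange R).unitSum :=
    ((baseChange_sum_one_equivalent R K).symm.trans h).trans (baseChange_sum_one_equivalent R K')
  have h2 : IsUnit (2 : ℝ) := two_ne_zero.isUnit
  refine ⟨equivalent_of_unitSum_of_isUnit_two h2 (baseChange_isSymm ℝ K') (key h.1), fun p hp => ?_⟩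
  rcases eq_or_ne p 2 with rfl | hp2
  · refine equivalent_of_unitSum_two_adic (baseChange_isSymm _ K') ?_ (key (h.2 2))
    rw [← isEven_iff_baseChange, ← isEven_iff_baseChange, hK]
  · refine equivalent_of_unitSum_of_isUnit_two ?_ (baseChange_isSymm _ K') (key (h.2 p))
    by_contra hu
    rw [PadicInt.not_isUnit_iff] at hu
    have h2 : (p : ℤ) ∣ 2 := (PadicInt.norm_int_lt_one_iff_dvd 2).1 (by exact_mod_cast hu)
    exact hp2 ((Nat.prime_dvd_prime_iff_eq hp.out Nat.prime_two).1 (by exact_mod_cast h2))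

/-- A vector of square `1` splits off. -/
theorem exists_iso_sum_one (L : IntegralLattice) {v : L.carrier} (hv : L.form v v = 1) :
    ∃ K, Iso L (sum one K) := by
  have hs : ∀ x y, L.form x y = L.form y x := fun x y => L.symm.eq x y
  have hproj : ∀ x, L.form v (x - L.form v x • v) = 0 := fun x => by simp [hv]
  let N := LinearMap.ker (L.form v)
  have hN : ∀ x : N, L.form v x = 0 := fun x => x.2
  have hnd : ∀ x : N, (∀ y : N, L.form x y = 0) → x = 0 := by
    intro x h
    refine Subtype.ext (L.nondegenerate.1 _ fun z => ?_)
    have hz := h ⟨z - L.form v z • v, hproj z⟩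
    simpa [hs x v, hN x] using hz
  let K : IntegralLattice :=
    { carrier := N
      form := L.form.comp N.subtype N.subtype
      symm := ⟨fun x y => hs x y⟩
      nondegenerate := ⟨hnd, fun y h => hnd y fun x => (hs y x).trans (h x)⟩ }
  let e : L.carrier ≃ₗ[ℤ] ℤ × N := LinearEquiv.ofLinearMap
    ((L.form v).prod (LinearMap.codRestrict N (LinearMap.id - (L.form v).smulRight v) hproj))
    ((LinearMap.toSpanSingleton ℤ _ v).coprod N.subtype)
    (LinearMap.ext fun x => by
      refine Prod.ext ?_ (Subtype.ext ?_)
      · change L.form v (x.1 • v + x.2) = x.1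
        simp [hv, hN]
      · change (x.1 • v + x.2 : L.carrier) - L.form v (x.1 • v + x.2) • v = x.2
        simp [hv, hN])
    (LinearMap.ext fun x => by
      change L.form v x • v + (x - L.form v x • v) = x
      abel)
  refine ⟨K, ⟨e, fun x y => ?_⟩⟩
  change L.form v x * L.form v y + L.form (x - L.form v x • v) (y - L.form v y • v) = L.form x y
  simp only [map_sub, map_smul, LinearMap.sub_apply, LinearMap.smul_apply, smul_eq_mul, hv, hs x v]
  ring

/-- Signs on `[1]` and automorphisms of `K` act independently on the sum. -/
theorem two_mul_card_aut_le (K : IntegralLattice) :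
    2 * ENat.card K.Aut ≤ ENat.card (sum one K).Aut := by
  let F : ℤˣ × K.Aut → (sum one K).Aut := fun a =>
    ⟨(DistribMulAction.toLinearEquiv ℤ ℤ a.1).prodCongr a.2.toLinearEquiv, fun (x y : ℤ × K.carrier) => by
      change (a.1 • x.1) * (a.1 • y.1) + K.form (a.2 x.2) (a.2 y.2) = x.1 * y.1 + K.form x.2 y.2
      rw [a.2.map_app, smul_mul_smul_comm, Int.units_mul_self, one_smul]⟩
  have hF : ∀ a x, F a x = (a.1 • x.1, a.2 x.2) := fun a x => rfl
  have hinj : Function.Injective F := by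
    intro a b h
    have h' : ∀ x, F a x = F b x := fun x => by rw [h]
    refine Prod.ext (Units.ext ?_) (DFunLike.ext _ _ fun x => ?_)
    · have h1 : a.1 • (1 : ℤ) = b.1 • (1 : ℤ) := congrArg Prod.fst (h' ((1 : ℤ), 0))
      simpa [Units.smul_def] using h1
    · exact congrArg Prod.snd (h' ((0 : ℤ), x))
  have h := ENat.card_le_card_of_injective hinj
  rwa [ENat.card_prod, ENat.card_eq_coe_fintype_card, Fintype.card_units_int] at h

end IntegralLattice

/-! ### Genera, twigs and masses. -/

namespace LatticeGenus

theorem ext_classes {f g : LatticeGenus} (h : f.classes = g.classes) : f = g := by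
  cases f
  cases g
  congr

theorem mem_ofLattice (L : IntegralLattice) : L ∈ ofLattice L :=
  ⟨L, SameGenus.refl L, rfl⟩

theorem sameGenus_of_mem {f : LatticeGenus} {L L' : IntegralLattice} (h : L ∈ f) (h' : L' ∈ f) :
    SameGenus L L' := by
  obtain ⟨L₀, h₀⟩ := f.exists_eq
  have key : ∀ M : IntegralLattice, M ∈ f → SameGenus L₀ M := by
    intro M hM
    change isoClass M ∈ f.classes at hM
    rw [h₀] at hM
    obtain ⟨M', hM', hMM'⟩ := hM
    have hiso : Iso M M' := Quotient.exact hMM'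
    exact hM'.trans hiso.sameGenus.symm
  exact (key L h).symm.trans (key L' h')

theorem mem_of_sameGenus {f : LatticeGenus} {L L' : IntegralLattice} (h : L ∈ f)
    (hLL' : SameGenus L L') : L' ∈ f := by
  obtain ⟨L₀, h₀⟩ := f.exists_eq
  have hL₀ : L₀ ∈ f := by
    change isoClass L₀ ∈ f.classes
    rw [h₀]
    exact ⟨L₀, SameGenus.refl L₀, rfl⟩
  change isoClass L' ∈ f.classes
  rw [h₀]
  exact ⟨L', (sameGenus_of_mem hL₀ h).trans hLL', rfl⟩

theorem eq_of_mem {f g : LatticeGenus} {L : IntegralLattice} (hf : L ∈ f) (hg : L ∈ g) :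
    f = g := by
  refine ext_classes (Set.ext fun c => ?_)
  induction c using Quotient.inductionOn with
  | h M => exact ⟨fun h => mem_of_sameGenus hg (sameGenus_of_mem hf h),
      fun h => mem_of_sameGenus hf (sameGenus_of_mem hg h)⟩

theorem isTwig_ofLattice {f : LatticeGenus} {K : IntegralLattice} (h : sum one K ∈ f) :
    (ofLattice K).IsTwig f :=
  eq_of_mem h ⟨K, mem_ofLattice K, mem_ofLattice (sum one K)⟩

/-- Splitting off `[1]` at least doubles the weight `1 / |Aut|`. -/
theorem two_mul_weight_le (K : IntegralLattice) :
    2 * (1 / ((isoClass (sum one K)).cardAut : ℝ≥0∞)) ≤ 1 / ((isoClass K).cardAut : ℝ≥0∞) := by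
  change 2 * (1 / (ENat.card (sum one K).Aut : ℝ≥0∞)) ≤ 1 / (ENat.card K.Aut : ℝ≥0∞)
  have h : (2 : ℝ≥0∞) * (ENat.card K.Aut : ℝ≥0∞) ≤ (ENat.card (sum one K).Aut : ℝ≥0∞) := by
    exact_mod_cast ENat.toENNReal_le.2 (two_mul_card_aut_le K)
  rw [one_div, one_div]
  calc (2 : ℝ≥0∞) * (ENat.card (sum one K).Aut : ℝ≥0∞)⁻¹
      ≤ 2 * (2 * (ENat.card K.Aut : ℝ≥0∞))⁻¹ := by gcongr
    _ = (ENat.card K.Aut : ℝ≥0∞)⁻¹ := by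
        rw [ENNReal.mul_inv (Or.inl two_ne_zero) (Or.inl ENNReal.ofNat_ne_top), ← mul_assoc,
          ENNReal.mul_inv_cancel two_ne_zero ENNReal.ofNat_ne_top, one_mul]

/-- The part of the mass of `f` that comes from complements in the genus `g` is at most half of the
mass of `g`. -/
theorem two_mul_tsum_le_mass {g : LatticeGenus} {S : Set IsoClass} (K : IsoClass → IntegralLattice)
    (hK : ∀ c ∈ S, isoClass (sum one (K c)) = c) (hg : ∀ c ∈ S, K c ∈ g) :
    2 * ∑' c : S, 1 / (c.1.cardAut : ℝ≥0∞) ≤ g.mass := by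
  let F : S → g.classes := fun c => ⟨isoClass (K c), hg c c.2⟩
  -- The class of the complement determines that of its sum with `[1]`.
  have hF : Function.Injective F := by
    intro c d h
    have hiso : Iso (K c) (K d) := Quotient.exact (congrArg Subtype.val h)
    apply Subtype.ext
    rw [← hK c c.2, ← hK d d.2]
    obtain ⟨e⟩ := hiso
    refine Quotient.sound ⟨⟨(LinearEquiv.refl ℤ ℤ).prodCongr e.toLinearEquiv,
      fun (x y : ℤ × (K c).carrier) => ?_⟩⟩
    change x.1 * y.1 + (K d).form (e x.2) (e y.2) = x.1 * y.1 + (K c).form x.2 y.2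
    rw [e.map_app]
  rw [← ENNReal.tsum_mul_left]
  refine le_trans (ENNReal.tsum_le_tsum fun c => ?_)
    (ENNReal.tsum_comp_le_tsum_of_injective hF fun c => 1 / (c.1.cardAut : ℝ≥0∞))
  conv_lhs => rw [← hK c c.2]
  exact two_mul_weight_le (K c)

end LatticeGenus

/-! ### Comparison of the two parities. -/

open LatticeGenus in
theorem mainTheorem10 (f : LatticeGenus) (hf : f.IsIdoneal) :
    ∃ g : LatticeGenus, g.IsTwig f ∧ g.IsSlender := by
  have hsplit : ∀ c : IsoClass, ∃ K : IntegralLattice,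
      c ∈ f.classes → isoClass (sum one K) = c := by
    intro c
    by_cases hc : c ∈ f.classes
    · obtain ⟨L, rfl⟩ := Quotient.exists_rep c
      obtain ⟨v, hv⟩ := hf.2 L hc
      obtain ⟨K, hK⟩ := L.exists_iso_sum_one hv
      exact ⟨K, fun _ => (Quotient.sound hK).symm⟩
    · exact ⟨one, fun h => absurd h hc⟩
  choose K hK using hsplit
  have hKf : ∀ c ∈ f.classes, sum one (K c) ∈ f := fun c hc => by
    change isoClass _ ∈ f.classes
    rwa [hK c hc]
  let w : IsoClass → ℝ≥0∞ := fun c => 1 / (c.cardAut : ℝ≥0∞)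
  let S : Prop → Set IsoClass := fun P => {c ∈ f.classes | (K c).IsEven ↔ P}
  -- one parity accounts for at least half of the mass
  have main : ∀ P, (S P).Nonempty → f.mass ≤ 2 * ∑' c : S P, w c →
      ∃ g : LatticeGenus, g.IsTwig f ∧ g.IsSlender := by
    rintro P ⟨c₀, hc₀, hP⟩ h
    have htwig := isTwig_ofLattice (hKf c₀ hc₀)
    refine ⟨ofLattice (K c₀), htwig, ?_⟩
    unfold IsSlender
    rw [← htwig]
    refine h.trans (two_mul_tsum_le_mass K (fun c hc => hK c hc.1) fun c hc => ?_)
    exact mem_of_sameGenus (mem_ofLattice (K c₀)) (SameGenus.of_sum_one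
      (sameGenus_of_mem (hKf c₀ hc₀) (hKf c hc.1)) (hP.trans hc.2.symm))
  have hle : f.mass ≤ ∑' c : S True, w c + ∑' c : S False, w c := by
    have hS : f.classes = S True ∪ S False := by
      ext c
      by_cases h : (K c).IsEven <;> simp [S, h]
    calc f.mass = ∑' c : (S True ∪ S False : Set IsoClass), w c := by rw [← hS]; rfl
      _ ≤ _ := ENNReal.tsum_union_le w _ _
  by_contra hcon
  have hlt : ∀ P, (S P).Nonempty → 2 * ∑' c : S P, w c < f.mass := fun P hP =>
    not_le.1 fun h => hcon (main P hP h)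
  obtain ⟨P, hP⟩ : ∃ P, (S P).Nonempty := by
    obtain ⟨L₀, h₀⟩ := f.exists_eq
    have hL₀ : isoClass L₀ ∈ f.classes := by
      rw [h₀]
      exact ⟨L₀, SameGenus.refl L₀, rfl⟩
    exact ⟨(K (isoClass L₀)).IsEven, isoClass L₀, hL₀, Iff.rfl⟩
  -- A parity that does not occur contributes 0, and the mass of `f` is positive by `hlt` for the
  -- parity that does.
  have hlt' : ∀ Q, 2 * ∑' c : S Q, w c < f.mass := by
    intro Q
    rcases (S Q).eq_empty_or_nonempty with h | h
    · rw [h]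
      simpa using bot_le.trans_lt (hlt P hP)
    · exact hlt Q h
  -- Both inequalities are strict, so the addition is valid in `[0, ∞]` without knowing that masses
  -- are finite.
  have h := ENNReal.add_lt_add (hlt' True) (hlt' False)
  rw [← mul_add, ← two_mul] at h
  exact absurd (mul_le_mul_right hle 2) (not_le.2 h)
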